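/- Let $n\ge 2$, let $\Omega\subset\mathbb R^n$ be a bounded domain (a bounded, nonempty, connected open set), and let $h\colon\mathbb R\to\mathbb R$ be continuous. For $A,B\in\mathbb R^{n\times n}$ put $A:B=\sum_{i,j}A^i_jB^i_j$, and let $\operatorname{cof}A$ denote the cofactor matrix of $A$, so that $A^T\operatorname{cof}A=(\det A)I$. For a map $u$ into $\mathbb R^n$ let $Du$ be its (weak) Jacobian matrix, $(Du)^i_j=\partial u^i/\partial x_j$. A map $u\in W^{1,1}_{loc}(\Omega;\mathbb R^n)$ is called a weak solution of $\operatorname{div}(h(\det Du)\operatorname{cof}Du)=0$ in $\Omega$ if $h(\det Du)\operatorname{cof}Du\in L^1_{loc}(\Omega;\mathbb R^{n\times n})$ and $$\int_\Omega h(\det Du)\operatorname{cof}Du:D\zeta\,dx=0\qquad\text{for all }\zeta\in C^1_c(\Omega;\mathbb R^n).$$ Let $n-1\le p\le\infty$ and $\bar p=\frac{p}{p+1-n}$, with $\bar p=\infty$ if $p=n-1$ and $\bar p=1$ if $p=\infty$. If $u\in W^{1,p}_{loc}(\Omega;\mathbb R^n)$ is a weak solution of $\operatorname{div}(h(\det Du)\operatorname{cof}Du)=0$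 in $\Omega$ and $h(\det Du)\in W^{1,\bar p}_{loc}(\Omega)$, then there is a constant $c\in\mathbb R$ with $h(\det Du)=c$ almost everywhere in $\Omega$. -/

import Mathlib

open MeasureTheory Set
open scoped ENNReal Matrix

/-- The partial derivative `∂φ/∂x_j` of a differentiable function `φ : ℝⁿ → ℝ`. -/
noncomputable def partialDeriv {n : ℕ} (j : Fin n) (φ : EuclideanSpace ℝ (Fin n) → ℝ)
    (x : EuclideanSpace ℝ (Fin n)) : ℝ :=
  fderiv ℝ φ x (EuclideanSpace.single j 1)

/-- The Jacobian matrix `(Dζ)^i_j = ∂ζ^i/∂x_j` of a differentiable map `ζ : ℝⁿ → ℝⁿ`. -/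
noncomputable def classicalJacobian {n : ℕ}
    (ζ : EuclideanSpace ℝ (Fin n) → EuclideanSpace ℝ (Fin n))
    (x : EuclideanSpace ℝ (Fin n)) : Matrix (Fin n) (Fin n) ℝ :=
  Matrix.of fun i j => partialDeriv j (fun y => ζ y i) x

/-- `f ∈ L^q_loc(Ω)`: `f` belongs to `L^q(K)` for every compact `K ⊆ Ω`. -/
def MemLpLoc {n : ℕ} (Ω : Set (EuclideanSpace ℝ (Fin n))) (q : ℝ≥0∞)
    (f : EuclideanSpace ℝ (Fin n) → ℝ) : Prop :=
  ∀ K : Set (EuclideanSpace ℝ (Fin n)), IsCompact K → K ⊆ Ω → MemLp f q (volume.restrict K)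

/-- `g` is a weak partial derivative of `f` on `Ω` in the `j`-th coordinate direction:
both are locally integrable on `Ω` and `∫_Ω f ∂_jφ = - ∫_Ω g φ` for all `φ ∈ C_c^∞(Ω)`. -/
def IsWeakPartial {n : ℕ} (Ω : Set (EuclideanSpace ℝ (Fin n))) (j : Fin n)
    (f g : EuclideanSpace ℝ (Fin n) → ℝ) : Prop :=
  MemLpLoc Ω 1 f ∧ MemLpLoc Ω 1 g ∧
    ∀ φ : EuclideanSpace ℝ (Fin n) → ℝ,
      ContDiff ℝ ((⊤ : ℕ∞) : WithTop ℕ∞) φ → HasCompactSupport φ → tsupport φ ⊆ Ω →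
        ∫ x in Ω, f x * partialDeriv j φ x = - ∫ x in Ω, g x * φ x

/-- `f ∈ W^{1,q}_loc(Ω)`, and `Df` is (a representative of) its weak gradient. -/
structure IsSobolevLoc {n : ℕ} (Ω : Set (EuclideanSpace ℝ (Fin n))) (q : ℝ≥0∞)
    (f : EuclideanSpace ℝ (Fin n) → ℝ) (Df : EuclideanSpace ℝ (Fin n) → Fin n → ℝ) : Prop where
  memLpLoc : MemLpLoc Ω q f
  memLpLoc_grad : ∀ j, MemLpLoc Ω q (fun x => Df x j)
  isWeakPartial : ∀ j, IsWeakPartial Ω j f (fun x => Df x j)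

/-- `f ∈ W^{1,q}_loc(Ω)`. -/
def MemSobolevLoc {n : ℕ} (Ω : Set (EuclideanSpace ℝ (Fin n))) (q : ℝ≥0∞)
    (f : EuclideanSpace ℝ (Fin n) → ℝ) : Prop :=
  ∃ Df : EuclideanSpace ℝ (Fin n) → Fin n → ℝ, IsSobolevLoc Ω q f Df

/-- `u ∈ W^{1,q}_loc(Ω; ℝⁿ)`, and `Du` is (a representative of) its weak Jacobian matrix,
`(Du)^i_j = ∂u^i/∂x_j`. -/
def IsSobolevMapLoc {n : ℕ} (Ω : Set (EuclideanSpace ℝ (Fin n))) (q : ℝ≥0∞)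
    (u : EuclideanSpace ℝ (Fin n) → EuclideanSpace ℝ (Fin n))
    (Du : EuclideanSpace ℝ (Fin n) → Matrix (Fin n) (Fin n) ℝ) : Prop :=
  ∀ i, IsSobolevLoc Ω q (fun x => u x i) (fun x j => Du x i j)

/-- The cofactor matrix, normalized by `Aᵀ cof A = (cof A) Aᵀ = (det A) I`. -/
def cofactorMatrix {n : ℕ} (A : Matrix (Fin n) (Fin n) ℝ) : Matrix (Fin n) (Fin n) ℝ :=
  A.adjugateᵀ

/-- `u`, with weak Jacobian matrix `Du`, is a weak solution of `div (h(det Du) cof Du) = 0`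
in `Ω`: `u ∈ W^{1,1}_loc(Ω; ℝⁿ)`, the field `h(det Du) cof Du` is in `L^1_loc`, and
`∫_Ω h(det Du) cof Du : Dζ dx = 0` for all `ζ ∈ C_c^1(Ω; ℝⁿ)`. -/
structure IsWeakSolution {n : ℕ} (Ω : Set (EuclideanSpace ℝ (Fin n))) (h : ℝ → ℝ)
    (u : EuclideanSpace ℝ (Fin n) → EuclideanSpace ℝ (Fin n))
    (Du : EuclideanSpace ℝ (Fin n) → Matrix (Fin n) (Fin n) ℝ) : Prop where
  isSobolevMapLoc : IsSobolevMapLoc Ω 1 u Du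
  memLpLoc_flux : ∀ i j, MemLpLoc Ω 1 (fun x => h (Du x).det * cofactorMatrix (Du x) i j)
  integral_eq_zero : ∀ ζ : EuclideanSpace ℝ (Fin n) → EuclideanSpace ℝ (Fin n),
    ContDiff ℝ 1 ζ → HasCompactSupport ζ → tsupport ζ ⊆ Ω →
      ∫ x in Ω, ∑ i, ∑ j,
        h (Du x).det * cofactorMatrix (Du x) i j * classicalJacobian ζ x i j = 0

/-- The exponent `p̄ = p / (p + 1 - n)` for `n - 1 ≤ p ≤ ∞`. At `p = n - 1` it is `∞` (division by
zero in `ℝ≥0∞`), and at `p = ∞` it is `1`, the limit, so that `p̄` is always the Hölder conjugate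
of `p / (n - 1)`. -/
noncomputable def barExponent (n : ℕ) (p : ℝ≥0∞) : ℝ≥0∞ :=
  if p = ∞ then 1 else p / (p + 1 - n)

/-! Write `f = h(det Du)`. The rows of `cof Du` are divergence free (Piola), so testing them with `f
φ` gives `∫ (cof Du)_i · (f ∇φ + φ ∇f) = 0`. The equation tested with `φ e_i` removes the first
term, and since `φ` is arbitrary, `cof Du ∇f = 0` a.e.
(`IsWeakSolution.ae_sum_cofactorMatrix_mul_eq_zero`). Where `det Du ≠ 0` the cofactor matrix is
invertible, so `∇f = 0`. Where `det Du = 0`, `f` takes the single value `h 0`, and a weak gradient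
vanishes a.e. on a level set (`IsWeakPartial.ae_eq_zero_of_eq_const`). Hence `∇f = 0` a.e., and
connectedness makes `f` constant.

The analytic point is Piola's identity at the critical integrability
(`sum_sign_mul_integral_eq_zero`), where the product of `n - 1` derivatives with `f` or `∇f` is only
just integrable. It holds for mollifications. At the endpoints these need not converge in `L^∞`, so
the limit rests on a.e. convergence and majorants of the form `mollify m G` with one integrable `G`:
they converge a.e. to `G` and all have the integral of `G`, which suffices for generalized dominated
convergence. -/

open Filter Topology
open scoped Convolution ContDiff

/-! ### Mollification on `ℝⁿ` -/

/-- A sequence of smooth bump functions at the origin whose supports shrink to a point. -/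
noncomputable def mollifierBump (n m : ℕ) : ContDiffBump (0 : EuclideanSpace ℝ (Fin n)) where
  rIn := 1 / (m + 1)
  rOut := 2 / (m + 1)
  rIn_pos := by positivity
  rIn_lt_rOut := by gcongr; norm_num

/-- The normalized smooth kernel of the `m`-th mollifier. -/
noncomputable def mollifier (n m : ℕ) : EuclideanSpace ℝ (Fin n) → ℝ :=
  (mollifierBump n m).normed volume

/-- The `m`-th mollification of `g`. -/
noncomputable def mollify {n : ℕ} (m : ℕ) (g : EuclideanSpace ℝ (Fin n) → ℝ) :
    EuclideanSpace ℝ (Fin n) → ℝ :=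
  mollifier n m ⋆[ContinuousLinearMap.lsmul ℝ ℝ, volume] g

section Mollify

variable {n : ℕ} {m : ℕ} {f g : EuclideanSpace ℝ (Fin n) → ℝ} {x : EuclideanSpace ℝ (Fin n)}

lemma mollifier_nonneg (t : EuclideanSpace ℝ (Fin n)) : 0 ≤ mollifier n m t :=
  ContDiffBump.nonneg_normed _ _

lemma mollifier_contDiff : ContDiff ℝ ∞ (mollifier n m) :=
  (mollifierBump n m).contDiff_normed

lemma mollifier_hasCompactSupport : HasCompactSupport (mollifier n m) :=
  (mollifierBump n m).hasCompactSupport_normed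

lemma tsupport_mollifier :
    tsupport (mollifier n m) = Metric.closedBall 0 (2 / ((m : ℝ) + 1)) :=
  (mollifierBump n m).tsupport_normed_eq

lemma integral_mollifier : ∫ t, mollifier n m t = 1 :=
  (mollifierBump n m).integral_normed

lemma mollify_apply : mollify m g x = ∫ t, mollifier n m t * g (x - t) := rfl

lemma mollify_apply_swap : mollify m g x = ∫ y, mollifier n m (x - y) * g y := by
  rw [mollify, convolution_eq_swap]; rfl

lemma integrable_mollifier_mul (hg : Integrable g) (x : EuclideanSpace ℝ (Fin n)) :
    Integrable (fun t => mollifier n m t * g (x - t)) := by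
  exact (mollifier_hasCompactSupport.convolutionExists_left (ContinuousLinearMap.lsmul ℝ ℝ)
    mollifier_contDiff.continuous hg.locallyIntegrable x)

lemma contDiff_mollify (hg : Integrable g) : ContDiff ℝ ∞ (mollify m g) :=
  mollifier_hasCompactSupport.contDiff_convolution_left _ mollifier_contDiff hg.locallyIntegrable

lemma integrable_mollify (hg : Integrable g) : Integrable (mollify m g) :=
  ((mollifierBump n m).integrable_normed).integrable_convolution _ hg

lemma integral_mollify (hg : Integrable g) : ∫ x, mollify m g x = ∫ x, g x := by
  have := integral_convolution (μ := volume) (ν := volume) (ContinuousLinearMap.lsmul ℝ ℝ)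
    ((mollifierBump n m).integrable_normed (μ := volume)) hg
  rw [(mollifierBump n m).integral_normed] at this
  simp only [one_mul, ContinuousLinearMap.lsmul_apply, smul_eq_mul] at this
  exact this

/-- This is Lebesgue differentiation; it needs the ratio of outer to inner radius to stay bounded,
and here it is always 2. -/
lemma ae_tendsto_mollify (hg : Integrable g) :
    ∀ᵐ x, Tendsto (fun m => mollify m g x) atTop (𝓝 (g x)) := by
  refine ContDiffBump.ae_convolution_tendsto_right_of_locallyIntegrable
    (φ := fun m => mollifierBump n m) (K := 2) ?_ ?_ hg.locallyIntegrable
  · have := (tendsto_one_div_add_atTop_nhds_zero_nat (𝕜 := ℝ)).const_mul 2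
    simpa [mollifierBump, div_eq_mul_inv] using this
  · refine Eventually.of_forall fun m => ?_
    simp [mollifierBump, div_eq_mul_inv]

lemma abs_mollify_le : |mollify m g x| ≤ mollify m (fun y => |g y|) x := by
  rw [mollify_apply, mollify_apply]
  refine (abs_integral_le_integral_abs).trans_eq ?_
  simp_rw [abs_mul, abs_of_nonneg (mollifier_nonneg _)]

lemma abs_mollify_le_of_ae_bound (hg : Integrable g) {M : ℝ} (hM : ∀ᵐ x, |g x| ≤ M)
    (x : EuclideanSpace ℝ (Fin n)) : |mollify m g x| ≤ M := by
  refine abs_mollify_le.trans ?_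
  rw [mollify_apply_swap]
  have h1 : ∫ y, mollifier n m (x - y) * M = M := by
    rw [integral_mul_const, integral_sub_left_eq_self (mollifier n m) volume x,
      integral_mollifier, one_mul]
  rw [← h1]
  refine integral_mono_ae ?_ ?_ ?_
  · have := (integrable_mollifier_mul (m := m) hg.abs x).comp_sub_left x
    simpa using this
  · exact (((mollifierBump n m).integrable_normed (μ := volume)).comp_sub_left x).mul_const M
  · filter_upwards [hM] with y hy
    exact mul_le_mul_of_nonneg_left hy (mollifier_nonneg _)

lemma mollify_add (hf : Integrable f) (hg : Integrable g) :
    mollify m (fun y => f y + g y) x = mollify m f x + mollify m g x := by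
  simp only [mollify_apply, mul_add]
  exact integral_add (integrable_mollifier_mul hf x) (integrable_mollifier_mul hg x)

lemma mollify_sum {ι : Type*} (s : Finset ι) {G : ι → EuclideanSpace ℝ (Fin n) → ℝ}
    (hG : ∀ i ∈ s, Integrable (G i)) :
    mollify m (fun y => ∑ i ∈ s, G i y) x = ∑ i ∈ s, mollify m (G i) x := by
  simp only [mollify_apply, Finset.mul_sum]
  exact integral_finsetSum s fun i hi => integrable_mollifier_mul (hG i hi) x

/-- Jensen's inequality for mollifications. -/
lemma abs_mollify_rpow_le (hg : Integrable g) {r : ℝ} (hr : 1 ≤ r)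
    (hgr : Integrable (fun x => |g x| ^ r)) (x : EuclideanSpace ℝ (Fin n)) :
    |mollify m g x| ^ r ≤ mollify m (fun y => |g y| ^ r) x := by
  have hmeas : Measurable (fun t => ENNReal.ofReal (mollifier n m t)) :=
    mollifier_contDiff.continuous.measurable.ennreal_ofReal
  -- The kernel is the density of a probability measure, so a mollification is an average and Jensen
  -- applies to `t ↦ t ^ r`.
  let ν : Measure (EuclideanSpace ℝ (Fin n)) :=
    volume.withDensity (fun t => ENNReal.ofReal (mollifier n m t))
  have hlt : ∀ᵐ t : EuclideanSpace ℝ (Fin n), ENNReal.ofReal (mollifier n m t) < ⊤ :=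
    Eventually.of_forall fun t => ENNReal.ofReal_lt_top
  have hν : IsProbabilityMeasure ν := by
    constructor
    rw [withDensity_apply _ MeasurableSet.univ, Measure.restrict_univ,
      ← ofReal_integral_eq_lintegral_ofReal (f := mollifier n m) ((mollifierBump n m).integrable_normed)
        (Eventually.of_forall mollifier_nonneg), integral_mollifier, ENNReal.ofReal_one]
  have hint : ∀ F : EuclideanSpace ℝ (Fin n) → ℝ,
      ∫ t, F (x - t) ∂ν = mollify m F x := by
    intro F
    rw [integral_withDensity_eq_integral_toReal_smul hmeas hlt, mollify_apply]
    simp [ENNReal.toReal_ofReal (mollifier_nonneg _)]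
  have hI : ∀ F : EuclideanSpace ℝ (Fin n) → ℝ, Integrable F →
      Integrable (fun t => F (x - t)) ν := by
    intro F hF
    rw [integrable_withDensity_iff_integrable_smul' hmeas hlt]
    simpa [ENNReal.toReal_ofReal (mollifier_nonneg _)] using integrable_mollifier_mul hF x
  have key := (convexOn_rpow hr).map_integral_le (μ := ν) (f := fun t => |g (x - t)|)
    (Real.continuous_rpow_const (by linarith)).continuousOn isClosed_Ici
    (Eventually.of_forall fun t => mem_Ici.2 (abs_nonneg _)) (hI (fun y => |g y|) hg.abs)
    (hI (fun y => |g y| ^ r) hgr)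
  rw [hint (fun y => |g y|)] at key
  rw [hint (fun y => |g y| ^ r)] at key
  exact (Real.rpow_le_rpow (abs_nonneg _) abs_mollify_le (by linarith)).trans key

end Mollify

/-! ### Mollification of weak derivatives -/

lemma partialDeriv_comp_sub_left {n : ℕ} {φ : EuclideanSpace ℝ (Fin n) → ℝ}
    (hφ : Differentiable ℝ φ) (j : Fin n) (x y : EuclideanSpace ℝ (Fin n)) :
    partialDeriv j (fun y => φ (x - y)) y = - partialDeriv j φ (x - y) := by
  have h1 : HasFDerivAt (fun y => x - y) (-ContinuousLinearMap.id ℝ _) y :=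
    (hasFDerivAt_id y).const_sub x
  have h2 := ((hφ (x - y)).hasFDerivAt.comp y h1).fderiv
  have h3 : φ ∘ (fun y => x - y) = fun y => φ (x - y) := rfl
  rw [h3] at h2
  simp [partialDeriv, h2]

lemma MemLpLoc.integrable_indicator {n : ℕ} {Ω K : Set (EuclideanSpace ℝ (Fin n))}
    {f : EuclideanSpace ℝ (Fin n) → ℝ} (hf : MemLpLoc Ω 1 f) (hK : IsCompact K) (hKΩ : K ⊆ Ω) :
    Integrable (K.indicator f) :=
  (integrable_indicator_iff hK.measurableSet).2 (memLp_one_iff_integrable.1 (hf K hK hKΩ))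

/-- Mollification commutes with weak differentiation, away from the boundary of the cut-off. -/
lemma partialDeriv_mollify {n : ℕ} {Ω K : Set (EuclideanSpace ℝ (Fin n))} {j : Fin n}
    {f g : EuclideanSpace ℝ (Fin n) → ℝ} (hfg : IsWeakPartial Ω j f g)
    (hK : IsCompact K) (hKΩ : K ⊆ Ω) {m : ℕ} {x : EuclideanSpace ℝ (Fin n)}
    (hx : Metric.closedBall x (2 / ((m : ℝ) + 1)) ⊆ K) :
    partialDeriv j (mollify m (K.indicator f)) x = mollify m (K.indicator g) x := by
  obtain ⟨hf, hg, H⟩ := hfg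
  have hF := hf.integrable_indicator hK hKΩ
  have hdiff : Differentiable ℝ (mollifier n m) := mollifier_contDiff.differentiable (by simp)
  -- The reflected, translated kernel is itself a test function. Its support lies in `K`, so cutting
  -- off by `K` changes no integral; the sign from the reflection cancels the one in the weak
  -- derivative.
  set φ : EuclideanSpace ℝ (Fin n) → ℝ := fun y => mollifier n m (x - y) with hφ
  have hsupp : tsupport φ ⊆ Metric.closedBall x (2 / ((m : ℝ) + 1)) := by
    refine closure_minimal ?_ Metric.isClosed_closedBall
    intro y hy
    have : x - y ∈ tsupport (mollifier n m) := subset_tsupport _ hy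
    rw [tsupport_mollifier] at this
    simpa [dist_eq_norm, norm_sub_rev] using this
  have hcpt : HasCompactSupport φ :=
    HasCompactSupport.of_support_subset_isCompact (isCompact_closedBall x _)
      ((subset_tsupport _).trans hsupp)
  have hφsm : ContDiff ℝ ∞ φ := mollifier_contDiff.comp (contDiff_const.sub contDiff_id)
  have h1 := H φ hφsm hcpt (hsupp.trans (hx.trans hKΩ))
  have hzero : ∀ y ∉ K, φ y = 0 := fun y hy =>
    image_eq_zero_of_notMem_tsupport fun h => hy (hx (hsupp h))
  have hzero' : ∀ y ∉ K, partialDeriv j φ y = 0 := fun y hy => by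
    have : fderiv ℝ φ y = 0 := by
      by_contra h
      exact hy (hx (hsupp (support_fderiv_subset ℝ h)))
    simp [partialDeriv, this]
  have hA : ∫ y in Ω, f y * partialDeriv j φ y = ∫ y, K.indicator f y * partialDeriv j φ y := by
    rw [setIntegral_eq_integral_of_forall_compl_eq_zero
      (fun y hy => by rw [hzero' y (fun h => hy (hKΩ h)), mul_zero])]
    refine integral_congr_ae (Eventually.of_forall fun y => ?_)
    by_cases hy : y ∈ K
    · simp [hy]
    · simp [hy, hzero' y hy]
  have hB : ∫ y in Ω, g y * φ y = ∫ y, K.indicator g y * φ y := by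
    rw [setIntegral_eq_integral_of_forall_compl_eq_zero
      (fun y hy => by rw [hzero y (fun h => hy (hKΩ h)), mul_zero])]
    refine integral_congr_ae (Eventually.of_forall fun y => ?_)
    by_cases hy : y ∈ K
    · simp [hy]
    · simp [hy, hzero y hy]
  have hD := (mollifier_hasCompactSupport (n := n) (m := m)).hasFDerivAt_convolution_left
    (μ := volume) (ContinuousLinearMap.lsmul ℝ ℝ) (mollifier_contDiff.of_le (by simp))
    hF.locallyIntegrable x
  have hC : partialDeriv j (mollify m (K.indicator f)) x
      = ∫ y, partialDeriv j (mollifier n m) (x - y) * K.indicator f y := by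
    rw [partialDeriv, mollify, hD.fderiv, convolution_eq_swap,
      ContinuousLinearMap.integral_apply]
    · rfl
    · have h2 := (mollifier_hasCompactSupport (n := n) (m := m)).fderiv (𝕜 := ℝ)
      have h3 := h2.convolutionExists_left
        ((ContinuousLinearMap.lsmul ℝ ℝ : ℝ →L[ℝ] ℝ →L[ℝ] ℝ).precompL (EuclideanSpace ℝ (Fin n)))
        (mollifier_contDiff.continuous_fderiv (by simp)) hF.locallyIntegrable x
      have h4 := Integrable.comp_sub_left h3 x
      simpa using h4
  rw [hC, mollify_apply_swap]
  rw [hA, hB] at h1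
  have h5 : ∀ y, partialDeriv j (mollifier n m) (x - y) * K.indicator f y
      = -(K.indicator f y * partialDeriv j φ y) := by
    intro y
    rw [partialDeriv_comp_sub_left hdiff]; ring
  simp_rw [h5]
  rw [integral_neg, h1, neg_neg]
  refine integral_congr_ae (Eventually.of_forall fun y => ?_)
  simp [hφ, mul_comm]

/-! ### Dominated convergence with moving majorants -/

/-- Dominated convergence with a convergent sequence of dominating functions. -/
theorem tendsto_integral_of_tendsto_integral_bound {α : Type*} [MeasurableSpace α] {μ : Measure α}
    {F G : ℕ → α → ℝ} {f g : α → ℝ} (hFm : ∀ m, AEStronglyMeasurable (F m) μ)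
    (hG : ∀ m, Integrable (G m) μ) (hg : Integrable g μ)
    (hbound : ∀ᶠ m in atTop, ∀ᵐ x ∂μ, |F m x| ≤ G m x)
    (hF : ∀ᵐ x ∂μ, Tendsto (fun m => F m x) atTop (𝓝 (f x)))
    (hGg : ∀ᵐ x ∂μ, Tendsto (fun m => G m x) atTop (𝓝 (g x)))
    (hint : Tendsto (fun m => ∫ x, G m x ∂μ) atTop (𝓝 (∫ x, g x ∂μ))) :
    Tendsto (fun m => ∫ x, F m x ∂μ) atTop (𝓝 (∫ x, f x ∂μ)) := by
  have hfg : ∀ᵐ x ∂μ, |f x| ≤ |g x| := by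
    filter_upwards [hF, hGg, eventually_atTop.1 hbound |>.choose_spec |> fun h =>
      ae_all_iff.2 fun m => (ae_all_iff.2 fun hm => h m hm)] with x h1 h2 h3
    refine le_trans (le_of_tendsto_of_tendsto h1.abs h2 ?_) (le_abs_self _)
    exact eventually_atTop.2 ⟨_, fun m hm => h3 m hm⟩
  -- the truncations of `F m` to `[-|g|, |g|]`
  set H : ℕ → α → ℝ := fun m x => max (-|g x|) (min (F m x) |g x|) with hH
  have hHm : ∀ m, AEStronglyMeasurable (H m) μ := fun m =>
    (hg.abs.aestronglyMeasurable.neg).sup ((hFm m).inf hg.abs.aestronglyMeasurable)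
  have hHb : ∀ m x, |H m x| ≤ |g x| := fun m x => by
    rw [abs_le]
    refine ⟨le_max_left _ _, max_le ?_ (min_le_right _ _)⟩
    linarith [abs_nonneg (g x)]
  have hHint : ∀ m, Integrable (H m) μ := fun m =>
    hg.abs.mono' (hHm m) (Eventually.of_forall (hHb m))
  have hHt : Tendsto (fun m => ∫ x, H m x ∂μ) atTop (𝓝 (∫ x, f x ∂μ)) := by
    refine tendsto_integral_of_dominated_convergence (fun x => |g x|) hHm hg.abs
      (fun m => Eventually.of_forall (hHb m)) ?_
    filter_upwards [hF, hfg] with x h1 h2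
    have h3 : max (-|g x|) (min (f x) |g x|) = f x := by
      rw [min_eq_left (abs_le.1 h2).2, max_eq_right (abs_le.1 h2).1]
    rw [← h3]
    exact tendsto_const_nhds.max (h1.min tendsto_const_nhds)
  -- the negative parts of `G m - g`
  have hN : Tendsto (fun m => ∫ x, max (g x - G m x) 0 ∂μ) atTop (𝓝 0) := by
    suffices h : Tendsto (fun m => ∫ x, max (g x - G m x) 0 ∂μ) atTop (𝓝 (∫ _, (0 : ℝ) ∂μ)) by
      simpa only [integral_zero] using h
    refine tendsto_integral_filter_of_dominated_convergence (fun x => |g x|)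
      (Eventually.of_forall fun m => ((hg.sub (hG m)).aestronglyMeasurable.sup
        aestronglyMeasurable_const)) ?_ hg.abs ?_
    · filter_upwards [hbound] with m hm
      filter_upwards [hm] with x hx
      rw [Real.norm_eq_abs, abs_of_nonneg (le_max_right _ _)]
      refine max_le ?_ (abs_nonneg _)
      linarith [abs_nonneg (F m x), le_abs_self (g x)]
    · filter_upwards [hGg] with x hx
      have h1 : Tendsto (fun m => max (g x - G m x) 0) atTop (𝓝 (max (g x - g x) 0)) :=
        (tendsto_const_nhds.sub hx).max tendsto_const_nhds
      simpa using h1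
  -- The positive part of `G m - g` is `G m - g` plus the negative part, and both have integrals
  -- tending to 0.
  have hP : Tendsto (fun m => ∫ x, max (G m x - g x) 0 ∂μ) atTop (𝓝 0) := by
    have h1 : ∀ m, ∫ x, max (G m x - g x) 0 ∂μ
        = ((∫ x, G m x ∂μ) - ∫ x, g x ∂μ) + ∫ x, max (g x - G m x) 0 ∂μ := by
      intro m
      rw [← integral_sub (hG m) hg,
        ← integral_add (f := fun x => G m x - g x) (g := fun x => max (g x - G m x) 0)
          ((hG m).sub hg) (hg.sub (hG m)).pos_part]
      refine integral_congr_ae (Eventually.of_forall fun x => ?_)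
      change max (G m x - g x) 0 = (G m x - g x) + max (g x - G m x) 0
      rcases le_total (G m x) (g x) with h | h
      · rw [max_eq_right (by linarith), max_eq_left (by linarith)]; ring
      · rw [max_eq_left (by linarith), max_eq_right (by linarith)]; ring
    simp_rw [h1]
    simpa using (hint.sub_const (∫ x, g x ∂μ)).add hN
  -- Since `|F m| ≤ G m`, truncation at `±|g|` moves `F m` by at most `(G m - g)⁺`.
  have hD : Tendsto (fun m => (∫ x, F m x ∂μ) - ∫ x, H m x ∂μ) atTop (𝓝 0) := by
    refine squeeze_zero_norm' ?_ hP
    filter_upwards [hbound] with m hm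
    have hFint : Integrable (F m) μ := (hG m).mono' (hFm m) hm
    rw [← integral_sub hFint (hHint m)]
    refine norm_integral_le_of_norm_le ((hG m).sub hg).pos_part ?_
    filter_upwards [hm] with x hx
    have h1 := abs_le.1 hx
    have h2 := le_abs_self (g x)
    have h3 := abs_nonneg (g x)
    change |F m x - max (-|g x|) (min (F m x) |g x|)| ≤ max (G m x - g x) 0
    rcases le_total (F m x) (|g x|) with h | h
    · rw [min_eq_left h]
      rcases le_total (-|g x|) (F m x) with h' | h'
      · rw [max_eq_right h']; simp
      · rw [max_eq_left h', abs_of_nonpos (by linarith)]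
        exact le_max_of_le_left (by linarith)
    · rw [min_eq_right h, max_eq_right (by linarith), abs_of_nonneg (by linarith)]
      exact le_max_of_le_left (by linarith)
  simpa using hD.add hHt

/-- Dominated convergence where the dominating functions are mollifications. -/
theorem tendsto_integral_of_le_mollify {n : ℕ} {F : ℕ → EuclideanSpace ℝ (Fin n) → ℝ}
    {f G : EuclideanSpace ℝ (Fin n) → ℝ} (hFm : ∀ m, AEStronglyMeasurable (F m) volume)
    (hG : Integrable G) (hbound : ∀ᶠ m in atTop, ∀ x, |F m x| ≤ mollify m G x)
    (hF : ∀ᵐ x, Tendsto (fun m => F m x) atTop (𝓝 (f x))) :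
    Tendsto (fun m => ∫ x, F m x) atTop (𝓝 (∫ x, f x)) := by
  refine tendsto_integral_of_tendsto_integral_bound hFm (fun m => integrable_mollify hG) hG
    (hbound.mono fun m h => Eventually.of_forall h) hF (ae_tendsto_mollify hG) ?_
  simp_rw [integral_mollify hG]
  exact tendsto_const_nhds

/-! ### The Piola identity for smooth maps -/

section Smooth

variable {n : ℕ}

lemma contDiff_partialDeriv {v : EuclideanSpace ℝ (Fin n) → ℝ} (hv : ContDiff ℝ ∞ v) (j : Fin n) :
    ContDiff ℝ ∞ (partialDeriv j v) :=
  (hv.fderiv_right (m := ∞) (by simp)).clm_apply contDiff_const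

lemma partialDeriv_comm {v : EuclideanSpace ℝ (Fin n) → ℝ} (hv : ContDiff ℝ ∞ v) (a b : Fin n)
    (x : EuclideanSpace ℝ (Fin n)) :
    partialDeriv a (partialDeriv b v) x = partialDeriv b (partialDeriv a v) x := by
  have hd : DifferentiableAt ℝ (fderiv ℝ v) x :=
    (hv.fderiv_right (m := ∞) (by simp)).differentiable (by simp) x
  have hsymm : IsSymmSndFDerivAt ℝ v x :=
    (hv.of_le (m := 2) (WithTop.coe_le_coe.2 le_top)).contDiffAt.isSymmSndFDerivAt (by simp)
  have key : ∀ a b : Fin n, partialDeriv a (partialDeriv b v) x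
      = fderiv ℝ (fderiv ℝ v) x (EuclideanSpace.single a 1) (EuclideanSpace.single b 1) := by
    intro a b
    have : partialDeriv b v = fun y => fderiv ℝ v y (EuclideanSpace.single b 1) := rfl
    rw [this, partialDeriv, fderiv_clm_apply hd (differentiableAt_const _)]
    simp
  rw [key, key, hsymm.eq]

lemma partialDeriv_mul {f g : EuclideanSpace ℝ (Fin n) → ℝ} {x : EuclideanSpace ℝ (Fin n)}
    (hf : DifferentiableAt ℝ f x) (hg : DifferentiableAt ℝ g x) (j : Fin n) :
    partialDeriv j (fun y => f y * g y) x
      = f x * partialDeriv j g x + partialDeriv j f x * g x := by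
  simp [partialDeriv, fderiv_fun_mul hf hg, mul_comm]

lemma partialDeriv_prod {ι : Type*} [DecidableEq ι] {s : Finset ι}
    {w : ι → EuclideanSpace ℝ (Fin n) → ℝ} {x : EuclideanSpace ℝ (Fin n)}
    (hw : ∀ k ∈ s, DifferentiableAt ℝ (w k) x) (j : Fin n) :
    partialDeriv j (fun y => ∏ k ∈ s, w k y) x
      = ∑ k ∈ s, (∏ l ∈ s.erase k, w l x) * partialDeriv j (w k) x := by
  have := (HasFDerivAt.finsetProd fun k hk => (hw k hk).hasFDerivAt).fderiv
  simp [partialDeriv, this]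

lemma HasCompactSupport.partialDeriv {ψ : EuclideanSpace ℝ (Fin n) → ℝ}
    (hψ : HasCompactSupport ψ) (j : Fin n) : HasCompactSupport (partialDeriv j ψ) :=
  (hψ.fderiv (𝕜 := ℝ)).comp_left
    (g := fun L : EuclideanSpace ℝ (Fin n) →L[ℝ] ℝ => L (EuclideanSpace.single j 1)) (by simp)

lemma partialDeriv_eq_zero_of_notMem_tsupport {ψ : EuclideanSpace ℝ (Fin n) → ℝ}
    {x : EuclideanSpace ℝ (Fin n)} (hx : x ∉ tsupport ψ) (j : Fin n) : partialDeriv j ψ x = 0 := by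
  have : fderiv ℝ ψ x = 0 := by
    by_contra h
    exact hx (support_fderiv_subset ℝ h)
  simp [_root_.partialDeriv, this]

lemma integral_mul_partialDeriv {f ψ : EuclideanSpace ℝ (Fin n) → ℝ} (hf : ContDiff ℝ ∞ f)
    (hψ : ContDiff ℝ ∞ ψ) (hc : HasCompactSupport ψ) (j : Fin n) :
    ∫ x, f x * partialDeriv j ψ x = - ∫ x, partialDeriv j f x * ψ x := by
  refine integral_mul_fderiv_eq_neg_fderiv_mul_of_integrable ?_ ?_ ?_ ?_ ?_
  · exact ((contDiff_partialDeriv hf j).continuous.mul hψ.continuous).integrable_of_hasCompactSupport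
      hc.mul_left
  · exact (hf.continuous.mul
      (contDiff_partialDeriv hψ j).continuous).integrable_of_hasCompactSupport
      (hc.partialDeriv j).mul_left
  · exact (hf.continuous.mul hψ.continuous).integrable_of_hasCompactSupport hc.mul_left
  · exact fun x _ => hf.differentiable (by simp) x
  · exact fun x _ => hψ.differentiable (by simp) x

/-- The Piola identity, pointwise. -/
lemma sum_sign_mul_partialDeriv_prod_eq_zero {v : Fin n → EuclideanSpace ℝ (Fin n) → ℝ}
    (hv : ∀ k, ContDiff ℝ ∞ (v k)) (i : Fin n) (x : EuclideanSpace ℝ (Fin n)) :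
    ∑ σ : Equiv.Perm (Fin n), ((Equiv.Perm.sign σ : ℤ) : ℝ) *
      partialDeriv (σ i)
        (fun y => ∏ k ∈ Finset.univ.erase i, partialDeriv (σ k) (v k) y) x = 0 := by
  have h1 : ∀ σ : Equiv.Perm (Fin n), partialDeriv (σ i)
        (fun y => ∏ k ∈ Finset.univ.erase i, partialDeriv (σ k) (v k) y) x
      = ∑ k ∈ Finset.univ.erase i,
        (∏ l ∈ (Finset.univ.erase i).erase k, partialDeriv (σ l) (v l) x) *
          partialDeriv (σ i) (partialDeriv (σ k) (v k)) x := fun σ =>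
    partialDeriv_prod
      (fun k _ => (contDiff_partialDeriv (hv k) (σ k)).differentiable (by simp) x) (σ i)
  simp_rw [h1, Finset.mul_sum]
  rw [Finset.sum_comm]
  refine Finset.sum_eq_zero fun k hk => ?_
  have hki : k ≠ i := (Finset.mem_erase.1 hk).1
  -- For fixed `k`, composing `σ` with the transposition of `i` and `k` flips the sign and exchanges
  -- the two derivatives falling on `v k`. Second derivatives commute, so the sum equals its own
  -- negative.
  refine self_eq_neg.1 ?_
  conv_lhs => rw [← Equiv.sum_comp (Equiv.mulRight (Equiv.swap i k))]
  rw [← Finset.sum_neg_distrib]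
  refine Finset.sum_congr rfl fun σ _ => ?_
  have h2 : ∏ l ∈ (Finset.univ.erase i).erase k,
        partialDeriv ((σ * Equiv.swap i k) l) (v l) x
      = ∏ l ∈ (Finset.univ.erase i).erase k, partialDeriv (σ l) (v l) x := by
    refine Finset.prod_congr rfl fun l hl => ?_
    simp only [Finset.mem_erase] at hl
    rw [Equiv.Perm.mul_apply, Equiv.swap_apply_of_ne_of_ne hl.2.1 hl.1]
  simp only [Equiv.coe_mulRight]
  rw [h2, Equiv.Perm.mul_apply, Equiv.Perm.mul_apply, Equiv.swap_apply_left,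
    Equiv.swap_apply_right, Equiv.Perm.sign_mul, Equiv.Perm.sign_swap hki.symm,
    partialDeriv_comm (hv k)]
  push_cast
  ring

/-- The Piola identity in weak form: cofactor rows of a gradient are divergence free. -/
lemma integral_sum_sign_mul_partialDeriv_eq_zero {v : Fin n → EuclideanSpace ℝ (Fin n) → ℝ}
    (hv : ∀ k, ContDiff ℝ ∞ (v k)) {ψ : EuclideanSpace ℝ (Fin n) → ℝ} (hψ : ContDiff ℝ ∞ ψ)
    (hc : HasCompactSupport ψ) (i : Fin n) :
    ∑ σ : Equiv.Perm (Fin n), ((Equiv.Perm.sign σ : ℤ) : ℝ) *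
      ∫ x, (∏ k ∈ Finset.univ.erase i, partialDeriv (σ k) (v k) x) * partialDeriv (σ i) ψ x
        = 0 := by
  have hP : ∀ σ : Equiv.Perm (Fin n), ContDiff ℝ ∞
      (fun y => ∏ k ∈ Finset.univ.erase i, partialDeriv (σ k) (v k) y) := fun σ =>
    contDiff_prod fun k _ => contDiff_partialDeriv (hv k) _
  simp_rw [fun σ => integral_mul_partialDeriv (hP σ) hψ hc (σ i), mul_neg,
    ← integral_const_mul]
  rw [Finset.sum_neg_distrib, neg_eq_zero, ← integral_finsetSum]
  · refine (integral_congr_ae (Eventually.of_forall fun x => ?_)).trans (integral_zero _ ℝ)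
    have := sum_sign_mul_partialDeriv_prod_eq_zero hv i x
    simp_rw [← mul_assoc, ← Finset.sum_mul, this]
    simp
  · intro σ _
    exact (((contDiff_partialDeriv (hP σ) _).continuous.mul
      hψ.continuous).integrable_of_hasCompactSupport hc.mul_left).const_mul _

end Smooth

/-! ### Conjugate exponents and integrable majorants -/

/-- Every factor is at most the largest one, whose power is one term of the sum. This crude bound
replaces Hölder for several factors, as only integrability is at stake. -/
lemma Finset.rpow_prod_le_sum_rpow {ι : Type*} {s : Finset ι} (hs : s.Nonempty) {a : ι → ℝ}
    (ha : ∀ k ∈ s, 0 ≤ a k) {r : ℝ} (hr : 0 ≤ r) :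
    (∏ k ∈ s, a k) ^ r ≤ ∑ k ∈ s, a k ^ ((s.card : ℝ) * r) := by
  obtain ⟨k₀, hk₀, hmax⟩ := s.exists_max_image a hs
  have h1 : ∏ k ∈ s, a k ≤ a k₀ ^ s.card :=
    (Finset.prod_le_prod ha hmax).trans_eq (Finset.prod_const _)
  calc (∏ k ∈ s, a k) ^ r ≤ (a k₀ ^ s.card) ^ r :=
        Real.rpow_le_rpow (Finset.prod_nonneg ha) h1 hr
    _ = a k₀ ^ ((s.card : ℝ) * r) := by rw [Real.rpow_mul (ha _ hk₀), Real.rpow_natCast]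
    _ ≤ ∑ k ∈ s, a k ^ ((s.card : ℝ) * r) :=
        Finset.single_le_sum (f := fun k => a k ^ ((s.card : ℝ) * r))
          (fun k hk => Real.rpow_nonneg (ha k hk) _) hk₀

lemma MeasureTheory.MemLp.exists_ae_abs_le {α : Type*} [MeasurableSpace α] {μ : Measure α}
    {f : α → ℝ} (hf : MemLp f ⊤ μ) : ∃ M : ℝ, 0 ≤ M ∧ ∀ᵐ x ∂μ, |f x| ≤ M := by
  refine ⟨(eLpNorm f ⊤ μ).toReal, ENNReal.toReal_nonneg, ?_⟩
  rw [eLpNorm_exponent_top]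
  filter_upwards [ae_le_eLpNormEssSup (f := f) (μ := μ)] with x hx
  have h := ENNReal.toReal_mono (by simpa using hf.2.ne) hx
  simpa using h

lemma barExponent_self {n : ℕ} (hn : 2 ≤ n) {p : ℝ≥0∞} (hp : p = (n : ℝ≥0∞) - 1) :
    barExponent n p = ⊤ := by
  have h1 : (1 : ℝ≥0∞) ≤ n := by exact_mod_cast (by omega : 1 ≤ n)
  have hne : p ≠ ⊤ := by rw [hp]; exact ENNReal.sub_ne_top (ENNReal.natCast_ne_top n)
  have h0 : p ≠ 0 := by
    rw [hp, ← Nat.cast_one, ← ENNReal.natCast_sub]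
    exact_mod_cast (by omega : n - 1 ≠ 0)
  have h2 : p + 1 - n = 0 := by rw [hp, tsub_add_cancel_of_le h1, tsub_self]
  rw [barExponent, if_neg hne, h2, ENNReal.div_zero h0]

/-- On the open range `n - 1 < p < ∞` both conjugate exponents are finite and exceed 1, as Young's
inequality requires; each endpoint pairs an `L^∞` bound with an integrable power instead. -/
lemma barExponent_of_lt {n : ℕ} {p : ℝ≥0∞} (hn : 2 ≤ n) (hp : (n : ℝ≥0∞) - 1 < p) (hp' : p ≠ ⊤) :
    barExponent n p ≠ 0 ∧ barExponent n p ≠ ⊤ ∧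
      (barExponent n p).toReal.HolderConjugate (p.toReal / ((n : ℝ) - 1)) := by
  have h1 : (1 : ℝ≥0∞) ≤ n := by exact_mod_cast (by omega : 1 ≤ n)
  have hlt : (n : ℝ≥0∞) < p + 1 := by
    rw [← tsub_add_cancel_of_le h1]
    exact (ENNReal.add_lt_add_iff_right (by simp)).2 hp
  have h0 : p ≠ 0 := (pos_of_gt hp).ne'
  have hsub : p + 1 - n ≠ 0 := (tsub_pos_of_lt hlt).ne'
  have hsub' : p + 1 - n ≠ ⊤ := ENNReal.sub_ne_top (by simp [hp'])
  have hb : barExponent n p = p / (p + 1 - n) := if_neg hp'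
  have hlt' : (n : ℝ) < p.toReal + 1 := by
    have := (ENNReal.toReal_lt_toReal (by simp) (by simp [hp'])).2 hlt
    rwa [ENNReal.toReal_add hp' (by simp), ENNReal.toReal_natCast, ENNReal.toReal_one] at this
  have hn' : (2 : ℝ) ≤ n := by exact_mod_cast hn
  have hr : (barExponent n p).toReal = p.toReal / (p.toReal + 1 - n) := by
    rw [hb, ENNReal.toReal_div, ENNReal.toReal_sub_of_le hlt.le (by simp [hp']),
      ENNReal.toReal_add hp' (by simp), ENNReal.toReal_natCast, ENNReal.toReal_one]
  refine ⟨?_, ?_, ?_⟩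
  · rw [hb]; simp [ENNReal.div_eq_zero_iff, h0, hsub']
  · rw [hb]; exact ENNReal.div_ne_top hp' hsub
  · rw [hr, Real.holderConjugate_iff]
    have hpos : 0 < p.toReal + 1 - n := by linarith
    refine ⟨?_, ?_⟩
    · rw [lt_div_iff₀ hpos]; linarith
    · have hn1 : (n : ℝ) - 1 ≠ 0 := by linarith
      have hp1 : p.toReal ≠ 0 := by linarith
      field_simp
      ring

lemma mollify_const_mul {n m : ℕ} {g : EuclideanSpace ℝ (Fin n) → ℝ} (c : ℝ)
    {x : EuclideanSpace ℝ (Fin n)} : mollify m (fun y => c * g y) x = c * mollify m g x := by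
  simp only [mollify_apply, ← integral_const_mul]
  refine integral_congr_ae (Eventually.of_forall fun t => ?_)
  simp only
  ring

/-- The product of the mollifications of functions with Hölder conjugate exponents is dominated by
the mollifications of an integrable function. -/
lemma exists_mollify_mul_prod_le {n : ℕ} (hn : 2 ≤ n) {p : ℝ≥0∞} (hp : (n : ℝ≥0∞) - 1 ≤ p)
    {ι : Type*} {s : Finset ι} (hs : s.card + 1 = n)
    {f : EuclideanSpace ℝ (Fin n) → ℝ} {g : ι → EuclideanSpace ℝ (Fin n) → ℝ}
    (hf : Integrable f) (hfq : MemLp f (barExponent n p) volume)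
    (hg : ∀ k ∈ s, Integrable (g k)) (hgp : ∀ k ∈ s, MemLp (g k) p volume) :
    ∃ G : EuclideanSpace ℝ (Fin n) → ℝ, Integrable G ∧
      ∀ m x, |mollify m f x| * ∏ k ∈ s, |mollify m (g k) x| ≤ mollify m G x := by
  have hcard : (s.card : ℝ) = (n : ℝ) - 1 := by rw [← hs]; push_cast; ring
  have hne : s.Nonempty := Finset.card_pos.1 (by omega)
  have hn' : (2 : ℝ) ≤ n := by exact_mod_cast hn
  -- With `(n - 1) r = p`, the `r`-th power of a product of `n - 1` factors is controlled by `p`-th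
  -- powers of the factors, to which Jensen applies.
  have hpow : ∀ r : ℝ, 1 ≤ r → ((n : ℝ) - 1) * r = p.toReal → p ≠ ⊤ → p ≠ 0 →
      Integrable (fun y => ∑ k ∈ s, |g k y| ^ p.toReal) ∧
      ∀ m x, (∏ k ∈ s, |mollify m (g k) x|) ^ r
        ≤ mollify m (fun y => ∑ k ∈ s, |g k y| ^ p.toReal) x := by
    intro r hr hrp hpt hp0
    have hi : ∀ k ∈ s, Integrable (fun y => |g k y| ^ p.toReal) := fun k hk =>
      (hgp k hk).integrable_norm_rpow hp0 hpt
    refine ⟨integrable_finsetSum s hi, fun m x => ?_⟩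
    rw [mollify_sum s hi]
    refine (Finset.rpow_prod_le_sum_rpow hne (fun k _ => abs_nonneg _) (by linarith)).trans ?_
    rw [hcard, hrp]
    refine Finset.sum_le_sum fun k hk => abs_mollify_rpow_le (hg k hk) ?_ (hi k hk) x
    rw [← hrp]
    nlinarith
  -- For `p = ∞` the product is bounded and `f` integrable; for `p = n - 1` the roles are reversed;
  -- in between, Young's inequality separates the two.
  by_cases hpt : p = ⊤
  · have hq : barExponent n p = 1 := if_pos hpt
    choose! M hM0 hM using fun k (hk : k ∈ s) => (hpt ▸ hgp k hk : MemLp (g k) ⊤ _).exists_ae_abs_le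
    refine ⟨fun y => (∏ k ∈ s, M k) * |f y|, hf.abs.const_mul _, fun m x => ?_⟩
    rw [mollify_const_mul, mul_comm]
    exact mul_le_mul (Finset.prod_le_prod (fun k _ => abs_nonneg _)
      fun k hk => abs_mollify_le_of_ae_bound (hg k hk) (hM k hk) x) abs_mollify_le (abs_nonneg _)
      (Finset.prod_nonneg hM0)
  rcases hp.eq_or_lt with hp | hp
  · have hpr : p.toReal = (n : ℝ) - 1 := by
      rw [← hp, ENNReal.toReal_sub_of_le (by exact_mod_cast (by omega : 1 ≤ n)) (by simp)]
      simp
    have hp0 : p ≠ 0 := by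
      rintro rfl
      rw [ENNReal.toReal_zero] at hpr
      linarith
    obtain ⟨hG, hGb⟩ := hpow 1 le_rfl (by rw [hpr, mul_one]) hpt hp0
    rw [barExponent_self hn hp.symm] at hfq
    obtain ⟨M, hM0, hM⟩ := hfq.exists_ae_abs_le
    refine ⟨fun y => M * ∑ k ∈ s, |g k y| ^ p.toReal, hG.const_mul _, fun m x => ?_⟩
    rw [mollify_const_mul]
    refine mul_le_mul (abs_mollify_le_of_ae_bound hf hM x) ?_
      (Finset.prod_nonneg fun _ _ => abs_nonneg _) hM0
    simpa only [Real.rpow_one] using hGb m x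
  · obtain ⟨hq0, hqt, hconj⟩ := barExponent_of_lt hn hp hpt
    have hr1 := hconj.symm.lt
    obtain ⟨hG, hGb⟩ := hpow (p.toReal / ((n : ℝ) - 1)) hr1.le
      (by rw [mul_div_cancel₀]; linarith) hpt (pos_of_gt hp).ne'
    have hfi : Integrable (fun y => |f y| ^ (barExponent n p).toReal) :=
      hfq.integrable_norm_rpow hq0 hqt
    refine ⟨fun y => |f y| ^ (barExponent n p).toReal + ∑ k ∈ s, |g k y| ^ p.toReal,
      hfi.add hG, fun m x => ?_⟩
    rw [mollify_add hfi hG]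
    refine (Real.young_inequality_of_nonneg (abs_nonneg _)
      (Finset.prod_nonneg fun _ _ => abs_nonneg _) hconj).trans (add_le_add ?_ ?_)
    · exact (div_le_self (Real.rpow_nonneg (abs_nonneg _) _) hconj.lt.le).trans
        (abs_mollify_rpow_le hf hconj.lt.le hfi x)
    · exact (div_le_self (Real.rpow_nonneg (Finset.prod_nonneg fun _ _ => abs_nonneg _) _)
        hr1.le).trans (hGb m x)

/-- Hölder's inequality, in the form in which it is used for cofactors. -/
lemma integrable_prod_mul {n : ℕ} (hn : 2 ≤ n) {p : ℝ≥0∞} (hp : (n : ℝ≥0∞) - 1 ≤ p)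
    {ι : Type*} {s : Finset ι} (hs : s.card + 1 = n)
    {f : EuclideanSpace ℝ (Fin n) → ℝ} {g : ι → EuclideanSpace ℝ (Fin n) → ℝ}
    (hf : Integrable f) (hfq : MemLp f (barExponent n p) volume)
    (hg : ∀ k ∈ s, Integrable (g k)) (hgp : ∀ k ∈ s, MemLp (g k) p volume) :
    Integrable (fun x => (∏ k ∈ s, g k x) * f x) := by
  obtain ⟨G, hG, hb⟩ := exists_mollify_mul_prod_le hn hp hs hf hfq hg hgp
  refine hG.mono' ((Finset.aestronglyMeasurable_fun_prod s
    fun k hk => (hg k hk).aestronglyMeasurable).mul hf.aestronglyMeasurable) ?_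
  have h1 : ∀ᵐ x, ∀ k ∈ s, Tendsto (fun m => mollify m (g k) x) atTop (𝓝 (g k x)) :=
    (Finset.eventually_all s).2 fun k hk => ae_tendsto_mollify (hg k hk)
  filter_upwards [h1, ae_tendsto_mollify hf, ae_tendsto_mollify hG] with x h1 h2 h3
  -- Letting `m → ∞` in the bound for mollifications shows that `G` dominates the product itself.
  have h4 := h2.abs.mul (tendsto_finsetProd s fun k hk => (h1 k hk).abs)
  rw [Real.norm_eq_abs, abs_mul, Finset.abs_prod, mul_comm]
  exact le_of_tendsto_of_tendsto' h4 h3 fun m => hb m x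

/-! ### The weak Piola identity against Sobolev functions -/

/-- Both sides are the determinant of `A` with row `i` replaced by `w`: by cofactor expansion and by
the Leibniz formula. The latter isolates products of exactly `n - 1` entries, the form the majorants
handle. -/
lemma sum_cofactorMatrix_mul {n : ℕ} (A : Matrix (Fin n) (Fin n) ℝ) (i : Fin n) (w : Fin n → ℝ) :
    ∑ j, cofactorMatrix A i j * w j = ∑ σ : Equiv.Perm (Fin n), ((Equiv.Perm.sign σ : ℤ) : ℝ) *
      ((∏ k ∈ Finset.univ.erase i, A k (σ k)) * w (σ i)) := by
  have h1 : ∑ j, cofactorMatrix A i j * w j = (A.updateRow i w).det := by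
    rw [← Matrix.cramer_transpose_apply, Matrix.cramer_eq_adjugate_mulVec,
      ← Matrix.adjugate_transpose]
    rfl
  rw [h1, ← Matrix.det_transpose, Matrix.det_apply']
  refine Finset.sum_congr rfl fun σ _ => ?_
  rw [← Finset.prod_erase_mul _ _ (Finset.mem_univ i)]
  congr 2
  · refine Finset.prod_congr rfl fun k hk => ?_
    rw [Matrix.transpose_apply, Matrix.updateRow_ne (Finset.ne_of_mem_erase hk)]
  · rw [Matrix.transpose_apply, Matrix.updateRow_self]

lemma MemLpLoc.memLp_indicator {n : ℕ} {Ω K : Set (EuclideanSpace ℝ (Fin n))} {q : ℝ≥0∞}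
    {f : EuclideanSpace ℝ (Fin n) → ℝ} (hf : MemLpLoc Ω q f) (hK : IsCompact K) (hKΩ : K ⊆ Ω) :
    MemLp (K.indicator f) q volume :=
  (memLp_indicator_iff_restrict hK.measurableSet).2 (hf K hK hKΩ)

/-- The set `K` leaves room around `S` for the supports of late mollifiers, so on `S` mollifying a
truncation to `K` is the same as mollifying the function. -/
lemma exists_compact_nhd {n : ℕ} {Ω S : Set (EuclideanSpace ℝ (Fin n))} (hΩ : IsOpen Ω)
    (hS : IsCompact S) (hSΩ : S ⊆ Ω) :
    ∃ K, IsCompact K ∧ K ⊆ Ω ∧ S ⊆ K ∧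
      ∀ᶠ m : ℕ in atTop, ∀ x ∈ S, Metric.closedBall x (2 / ((m : ℝ) + 1)) ⊆ K := by
  obtain ⟨δ, hδ, h⟩ := hS.exists_cthickening_subset_open hΩ hSΩ
  refine ⟨Metric.cthickening δ S, hS.cthickening, h, Metric.self_subset_cthickening S, ?_⟩
  have h1 : Tendsto (fun m : ℕ => 2 / ((m : ℝ) + 1)) atTop (𝓝 0) := by
    have := (tendsto_one_div_add_atTop_nhds_zero_nat (𝕜 := ℝ)).const_mul 2
    simpa [div_eq_mul_inv] using this
  filter_upwards [h1.eventually_le_const hδ] with m hm x hx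
  exact (Metric.closedBall_subset_closedBall hm).trans
    (Metric.closedBall_subset_cthickening hx δ)

section ProductRule

variable {n : ℕ} {Ω : Set (EuclideanSpace ℝ (Fin n))} {p : ℝ≥0∞}
  {u : EuclideanSpace ℝ (Fin n) → EuclideanSpace ℝ (Fin n)}
  {Du : EuclideanSpace ℝ (Fin n) → Matrix (Fin n) (Fin n) ℝ}

lemma integrable_indicator_prod_mul (hn : 2 ≤ n) (hp : (n : ℝ≥0∞) - 1 ≤ p)
    (hu : IsSobolevMapLoc Ω p u Du) {w : EuclideanSpace ℝ (Fin n) → ℝ} (hw : MemLpLoc Ω 1 w)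
    (hwq : MemLpLoc Ω (barExponent n p) w) (i : Fin n) (σ : Fin n → Fin n)
    {K : Set (EuclideanSpace ℝ (Fin n))} (hK : IsCompact K) (hKΩ : K ⊆ Ω) :
    Integrable (K.indicator fun x => (∏ k ∈ Finset.univ.erase i, Du x k (σ k)) * w x) := by
  have hcard : (Finset.univ.erase i).card + 1 = n := by
    rw [Finset.card_erase_add_one (Finset.mem_univ i), Finset.card_univ, Fintype.card_fin]
  have h := integrable_prod_mul hn hp hcard (g := fun k => K.indicator fun x => Du x k (σ k))
    (hw.integrable_indicator hK hKΩ) (hwq.memLp_indicator hK hKΩ)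
    (fun k _ => ((hu k).isWeakPartial (σ k)).2.1.integrable_indicator hK hKΩ)
    (fun k _ => ((hu k).memLpLoc_grad (σ k)).memLp_indicator hK hKΩ)
  refine h.congr (Eventually.of_forall fun x => ?_)
  by_cases hx : x ∈ K
  · simp [hx]
  · simp [hx]

/-- Cofactor rows of a weak Jacobian are divergence free, tested against `f φ` with `f` in the
Sobolev space of conjugate exponent. -/
theorem sum_sign_mul_integral_eq_zero (hΩ : IsOpen Ω) (hn : 2 ≤ n) (hp : (n : ℝ≥0∞) - 1 ≤ p)
    (hu : IsSobolevMapLoc Ω p u Du) {f : EuclideanSpace ℝ (Fin n) → ℝ}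
    {Df : EuclideanSpace ℝ (Fin n) → Fin n → ℝ} (hf : IsSobolevLoc Ω (barExponent n p) f Df)
    {φ : EuclideanSpace ℝ (Fin n) → ℝ} (hφ : ContDiff ℝ ∞ φ) (hc : HasCompactSupport φ)
    (hφΩ : tsupport φ ⊆ Ω) (i : Fin n) :
    ∑ σ : Equiv.Perm (Fin n), ((Equiv.Perm.sign σ : ℤ) : ℝ) *
      ∫ x, (∏ k ∈ Finset.univ.erase i, Du x k (σ k)) *
        (f x * partialDeriv (σ i) φ x + Df x (σ i) * φ x) = 0 := by
  obtain ⟨K, hK, hKΩ, hφK, hball⟩ := exists_compact_nhd hΩ hc hφΩ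
  have hcard : (Finset.univ.erase i).card + 1 = n := by
    rw [Finset.card_erase_add_one (Finset.mem_univ i), Finset.card_univ, Fintype.card_fin]
  have hfi : Integrable (K.indicator f) := (hf.isWeakPartial i).1.integrable_indicator hK hKΩ
  have hDfi : ∀ j, Integrable (K.indicator fun x => Df x j) := fun j =>
    (hf.isWeakPartial j).2.1.integrable_indicator hK hKΩ
  have hui : ∀ k, Integrable (K.indicator fun x => u x k) := fun k =>
    ((hu k).isWeakPartial k).1.integrable_indicator hK hKΩ
  have hDui : ∀ k j, Integrable (K.indicator fun x => Du x k j) := fun k j =>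
    ((hu k).isWeakPartial j).2.1.integrable_indicator hK hKΩ
  have hlim : ∀ σ : Equiv.Perm (Fin n), Tendsto (fun m => ∫ x,
      (∏ k ∈ Finset.univ.erase i, mollify m (K.indicator fun y => Du y k (σ k)) x) *
        (mollify m (K.indicator f) x * partialDeriv (σ i) φ x
          + mollify m (K.indicator fun y => Df y (σ i)) x * φ x)) atTop
      (𝓝 (∫ x, (∏ k ∈ Finset.univ.erase i, Du x k (σ k)) *
        (f x * partialDeriv (σ i) φ x + Df x (σ i) * φ x))) := by
    intro σ
    obtain ⟨G₁, hG₁, hb₁⟩ := exists_mollify_mul_prod_le hn hp hcard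
      (g := fun k => K.indicator fun x => Du x k (σ k)) hfi (hf.memLpLoc.memLp_indicator hK hKΩ)
      (fun k _ => hDui k (σ k)) (fun k _ => ((hu k).memLpLoc_grad (σ k)).memLp_indicator hK hKΩ)
    obtain ⟨G₂, hG₂, hb₂⟩ := exists_mollify_mul_prod_le hn hp hcard
      (g := fun k => K.indicator fun x => Du x k (σ k)) (hDfi (σ i))
      ((hf.memLpLoc_grad (σ i)).memLp_indicator hK hKΩ)
      (fun k _ => hDui k (σ k)) (fun k _ => ((hu k).memLpLoc_grad (σ k)).memLp_indicator hK hKΩ)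
    have hdc := (contDiff_partialDeriv hφ (σ i)).continuous
    obtain ⟨A, hA⟩ := hdc.bounded_above_of_compact_support (hc.partialDeriv (σ i))
    obtain ⟨B, hB⟩ := hφ.continuous.bounded_above_of_compact_support hc
    simp only [Real.norm_eq_abs] at hA hB
    refine tendsto_integral_of_le_mollify (G := fun x => A * G₁ x + B * G₂ x) ?_
      ((hG₁.const_mul A).add (hG₂.const_mul B)) ?_ ?_
    · intro m
      refine Continuous.aestronglyMeasurable ?_
      refine (continuous_finsetProd _ fun k _ => (contDiff_mollify (hDui k _)).continuous).mul ?_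
      exact ((contDiff_mollify hfi).continuous.mul hdc).add
        ((contDiff_mollify (hDfi _)).continuous.mul hφ.continuous)
    · refine Eventually.of_forall fun m x => ?_
      rw [mollify_add (hG₁.const_mul A) (hG₂.const_mul B), mollify_const_mul, mollify_const_mul]
      have h1 := hb₁ m x
      have h2 := hb₂ m x
      rw [abs_mul, Finset.abs_prod]
      set P := ∏ k ∈ Finset.univ.erase i, |mollify m (K.indicator fun y => Du y k (σ k)) x|
      have hP : 0 ≤ P := Finset.prod_nonneg fun _ _ => abs_nonneg _
      set a := mollify m (K.indicator f) x
      set b := mollify m (K.indicator fun y => Df y (σ i)) x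
      have hA0 : 0 ≤ A := (abs_nonneg _).trans (hA x)
      have hB0 : 0 ≤ B := (abs_nonneg _).trans (hB x)
      calc P * |a * partialDeriv (σ i) φ x + b * φ x|
          ≤ P * (|a| * |partialDeriv (σ i) φ x| + |b| * |φ x|) := by
            rw [← abs_mul, ← abs_mul]
            exact mul_le_mul_of_nonneg_left (abs_add_le _ _) hP
        _ ≤ P * (|a| * A + |b| * B) := by
            gcongr
            · exact hA x
            · exact hB x
        _ = A * (|a| * P) + B * (|b| * P) := by ring
        _ ≤ _ := by gcongr
    · have h1 : ∀ᵐ x, ∀ k, Tendsto (fun m => mollify m (K.indicator fun y => Du y k (σ k)) x)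
          atTop (𝓝 (K.indicator (fun y => Du y k (σ k)) x)) :=
        ae_all_iff.2 fun k => ae_tendsto_mollify (hDui k _)
      filter_upwards [h1, ae_tendsto_mollify hfi, ae_tendsto_mollify (hDfi (σ i))] with x h1 h2 h3
      have h4 := (tendsto_finsetProd (Finset.univ.erase i) fun k _ => h1 k).mul
        ((h2.mul_const (partialDeriv (σ i) φ x)).add (h3.mul_const (φ x)))
      -- Outside `K` both `φ` and its derivatives vanish, so the truncations do not affect the
      -- limit.
      convert h4 using 2
      by_cases hx : x ∈ K
      · simp [hx]
      · have hx' : x ∉ tsupport φ := fun h => hx (hφK h)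
        simp [partialDeriv_eq_zero_of_notMem_tsupport hx',
          image_eq_zero_of_notMem_tsupport hx']
  have hsum := tendsto_finsetSum Finset.univ
    fun (σ : Equiv.Perm (Fin n)) _ => (hlim σ).const_mul ((Equiv.Perm.sign σ : ℤ) : ℝ)
  -- For large `m` the approximating sum is exactly zero: it is the smooth Piola identity tested
  -- with the mollified `f` times `φ`.
  refine tendsto_nhds_unique hsum ((tendsto_congr' ?_).2 tendsto_const_nhds)
  filter_upwards [hball] with m hm
  have hF := contDiff_mollify (m := m) hfi
  have hP := integral_sum_sign_mul_partialDeriv_eq_zero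
    (v := fun k => mollify m (K.indicator fun x => u x k)) (fun k => contDiff_mollify (hui k))
    (ψ := fun x => mollify m (K.indicator f) x * φ x) (hF.mul hφ) hc.mul_left i
  rw [← hP]
  refine Finset.sum_congr rfl fun σ _ => ?_
  congr 1
  refine integral_congr_ae (Eventually.of_forall fun x => ?_)
  simp only
  rw [partialDeriv_mul (hF.differentiable (by simp) x) (hφ.differentiable (by simp) x)]
  by_cases hx : x ∈ tsupport φ
  · rw [partialDeriv_mollify (hf.isWeakPartial (σ i)) hK hKΩ (hm x hx)]
    congr 1
    refine Finset.prod_congr rfl fun k _ => ?_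
    rw [partialDeriv_mollify ((hu k).isWeakPartial (σ k)) hK hKΩ (hm x hx)]
  · simp [partialDeriv_eq_zero_of_notMem_tsupport hx, image_eq_zero_of_notMem_tsupport hx]

end ProductRule

/-! ### The equation tested against the Piola identity -/

section WeakSolution

variable {n : ℕ} {Ω : Set (EuclideanSpace ℝ (Fin n))} {p : ℝ≥0∞}
  {u : EuclideanSpace ℝ (Fin n) → EuclideanSpace ℝ (Fin n)}
  {Du : EuclideanSpace ℝ (Fin n) → Matrix (Fin n) (Fin n) ℝ}

lemma tsupport_partialDeriv_subset {φ : EuclideanSpace ℝ (Fin n) → ℝ} (j : Fin n) :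
    tsupport (partialDeriv j φ) ⊆ tsupport φ := by
  refine closure_minimal (fun x hx => ?_) (isClosed_tsupport φ)
  by_contra h
  exact hx (partialDeriv_eq_zero_of_notMem_tsupport h j)

/-- Integrability of the `f ∂φ` and `φ ∂f` terms separately is what permits splitting the integral
from the product rule. -/
lemma integrable_prod_mul_test (hn : 2 ≤ n) (hp : (n : ℝ≥0∞) - 1 ≤ p)
    (hu : IsSobolevMapLoc Ω p u Du) {w : EuclideanSpace ℝ (Fin n) → ℝ} (hw : MemLpLoc Ω 1 w)
    (hwq : MemLpLoc Ω (barExponent n p) w) (i : Fin n) (σ : Fin n → Fin n)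
    {c : EuclideanSpace ℝ (Fin n) → ℝ} (hc : Continuous c) (hcc : HasCompactSupport c)
    (hcΩ : tsupport c ⊆ Ω) :
    Integrable fun x => (∏ k ∈ Finset.univ.erase i, Du x k (σ k)) * (w x * c x) := by
  have h := integrable_indicator_prod_mul hn hp hu hw hwq i σ hcc hcΩ
  obtain ⟨B, hB⟩ := hc.bounded_above_of_compact_support hcc
  refine (h.mul_bdd (c := B) hc.aestronglyMeasurable (Eventually.of_forall hB)).congr
    (Eventually.of_forall fun x => ?_)
  by_cases hx : x ∈ tsupport c
  · simp [hx, mul_assoc]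
  · simp [image_eq_zero_of_notMem_tsupport hx]

lemma classicalJacobian_single {φ : EuclideanSpace ℝ (Fin n) → ℝ} (i : Fin n)
    (x : EuclideanSpace ℝ (Fin n)) (a b : Fin n) :
    classicalJacobian (fun y => EuclideanSpace.single i (φ y)) x a b
      = if a = i then partialDeriv b φ x else 0 := by
  by_cases h : a = i
  · subst h
    simp [classicalJacobian]
  · simp [classicalJacobian, h, partialDeriv]

/-- Testing the equation and the divergence-free property of the cofactors against each other:
the weak gradient of `h (det Du)` is annihilated by `cof Du`. -/
theorem IsWeakSolution.ae_sum_cofactorMatrix_mul_eq_zero {h : ℝ → ℝ} (hΩ : IsOpen Ω) (hn : 2 ≤ n)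
    (hp : (n : ℝ≥0∞) - 1 ≤ p) (hu : IsSobolevMapLoc Ω p u Du) (hsol : IsWeakSolution Ω h u Du)
    {Df : EuclideanSpace ℝ (Fin n) → Fin n → ℝ}
    (hf : IsSobolevLoc Ω (barExponent n p) (fun x => h (Du x).det) Df) (i : Fin n) :
    ∀ᵐ x, x ∈ Ω → ∑ j, cofactorMatrix (Du x) i j * Df x j = 0 := by
  have hDf1 : ∀ j, MemLpLoc Ω 1 (fun x => Df x j) := fun j => (hf.isWeakPartial j).2.1
  have hf1 : MemLpLoc Ω 1 (fun x => h (Du x).det) := (hf.isWeakPartial i).1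
  refine hΩ.ae_eq_zero_of_integral_contDiff_smul_eq_zero ?_ ?_
  · rw [locallyIntegrableOn_iff hΩ.isLocallyClosed]
    intro K hKΩ hK
    simp_rw [sum_cofactorMatrix_mul]
    refine integrable_finsetSum _ fun σ _ => Integrable.const_mul ?_ _
    exact (integrable_indicator_iff hK.measurableSet).1
      (integrable_indicator_prod_mul hn hp hu (hDf1 (σ i)) (hf.memLpLoc_grad (σ i)) i σ hK hKΩ)
  · intro φ hφ hc hφΩ
    have hI : ∀ σ : Equiv.Perm (Fin n), Integrable fun x =>
        (∏ k ∈ Finset.univ.erase i, Du x k (σ k)) *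
          (h (Du x).det * partialDeriv (σ i) φ x) := fun σ =>
      integrable_prod_mul_test hn hp hu hf1 hf.memLpLoc i σ
        (contDiff_partialDeriv hφ (σ i)).continuous (hc.partialDeriv (σ i))
        ((tsupport_partialDeriv_subset _).trans hφΩ)
    have hJ : ∀ σ : Equiv.Perm (Fin n), Integrable fun x =>
        (∏ k ∈ Finset.univ.erase i, Du x k (σ k)) * (Df x (σ i) * φ x) := fun σ =>
      integrable_prod_mul_test hn hp hu (hDf1 (σ i)) (hf.memLpLoc_grad (σ i)) i σ
        hφ.continuous hc hφΩ
    have key := sum_sign_mul_integral_eq_zero hΩ hn hp hu hf hφ hc hφΩ i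
    simp_rw [mul_add, fun σ => integral_add (hI σ) (hJ σ), mul_add, Finset.sum_add_distrib] at key
    -- This is the equation for the test field `φ e_i`, whose Jacobian has only row `i` nonzero.
    have hS : ∑ σ : Equiv.Perm (Fin n), ((Equiv.Perm.sign σ : ℤ) : ℝ) *
        ∫ x, (∏ k ∈ Finset.univ.erase i, Du x k (σ k)) *
          (h (Du x).det * partialDeriv (σ i) φ x) = 0 := by
      have hsupp : tsupport (fun x => EuclideanSpace.single i (φ x)) ⊆ tsupport φ := by
        refine closure_mono fun x hx => ?_
        contrapose! hx
        simp only [Function.mem_support, not_not] at hx ⊢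
        simp [hx]
      have hζ : ContDiff ℝ 1 (fun x => EuclideanSpace.single i (φ x)) := by
        rw [contDiff_euclidean]
        intro a
        by_cases ha : a = i
        · subst ha
          simpa using hφ.of_le (by simp)
        · simpa [ha] using contDiff_const
      have hz := hsol.integral_eq_zero _ hζ (hc.of_isClosed_subset (isClosed_tsupport _) hsupp)
        (hsupp.trans hφΩ)
      simp_rw [← integral_const_mul]
      rw [← integral_finsetSum _ fun σ _ => (hI σ).const_mul _, ← hz,
        setIntegral_eq_integral_of_forall_compl_eq_zero]
      · refine integral_congr_ae (Eventually.of_forall fun x => ?_)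
        simp only [classicalJacobian_single]
        have := sum_cofactorMatrix_mul (Du x) i fun j => h (Du x).det * partialDeriv j φ x
        rw [← this]
        symm
        rw [Finset.sum_eq_single i]
        · refine Finset.sum_congr rfl fun j _ => ?_
          rw [if_pos rfl]; ring
        · intro a _ ha
          simp [ha]
        · simp
      · intro x hx
        simp [classicalJacobian_single,
          partialDeriv_eq_zero_of_notMem_tsupport fun h => hx (hφΩ h)]
    rw [hS, zero_add] at key
    simp_rw [← integral_const_mul] at key
    rw [← integral_finsetSum _ fun σ _ => (hJ σ).const_mul _] at key
    rw [← key]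
    refine integral_congr_ae (Eventually.of_forall fun x => ?_)
    simp only [sum_cofactorMatrix_mul, smul_eq_mul, Finset.mul_sum]
    exact Finset.sum_congr rfl fun σ _ => by ring

end WeakSolution

/-! ### Weak derivatives on level sets -/

section LevelSet

variable {n : ℕ} {Ω : Set (EuclideanSpace ℝ (Fin n))} {j : Fin n}
  {f g : EuclideanSpace ℝ (Fin n) → ℝ}

/-- The chain rule for weak derivatives. -/
lemma IsWeakPartial.integral_comp_mul_partialDeriv (hΩ : IsOpen Ω) (hfg : IsWeakPartial Ω j f g)
    {Φ Φ' : ℝ → ℝ} (hΦ : ContDiff ℝ ∞ Φ) (hΦ' : ∀ t, HasDerivAt Φ (Φ' t) t) {A B : ℝ}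
    (hA : ∀ t, |Φ t| ≤ A) (hB : ∀ t, |Φ' t| ≤ B) {φ : EuclideanSpace ℝ (Fin n) → ℝ}
    (hφ : ContDiff ℝ ∞ φ) (hc : HasCompactSupport φ) (hφΩ : tsupport φ ⊆ Ω) :
    ∫ x, Φ (f x) * partialDeriv j φ x = - ∫ x, Φ' (f x) * g x * φ x := by
  obtain ⟨K, hK, hKΩ, hφK, hball⟩ := exists_compact_nhd hΩ hc hφΩ
  have hF := hfg.1.integrable_indicator hK hKΩ
  have hG := hfg.2.1.integrable_indicator hK hKΩ
  have hdφ := contDiff_partialDeriv hφ j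
  have hcont : Continuous Φ' := by
    have : Φ' = deriv Φ := funext fun t => (hΦ' t).deriv.symm
    rw [this]
    exact hΦ.continuous_deriv (by simp)
  have hL : Tendsto (fun m => ∫ x, Φ (mollify m (K.indicator f) x) * partialDeriv j φ x) atTop
      (𝓝 (∫ x, Φ (f x) * partialDeriv j φ x)) := by
    refine tendsto_integral_of_dominated_convergence (fun x => A * |partialDeriv j φ x|) ?_ ?_ ?_ ?_
    · exact fun m => ((hΦ.continuous.comp (contDiff_mollify hF).continuous).mul
        hdφ.continuous).aestronglyMeasurable
    · exact (hdφ.continuous.integrable_of_hasCompactSupport (hc.partialDeriv j)).abs.const_mul A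
    · refine fun m => Eventually.of_forall fun x => ?_
      rw [Real.norm_eq_abs, abs_mul]
      exact mul_le_mul_of_nonneg_right (hA _) (abs_nonneg _)
    · filter_upwards [ae_tendsto_mollify hF] with x hx
      by_cases hxK : x ∈ K
      · rw [indicator_of_mem hxK] at hx
        exact ((hΦ.continuous.tendsto _).comp hx).mul_const _
      · simp [partialDeriv_eq_zero_of_notMem_tsupport fun h => hxK (hφK h)]
  -- The mollified derivative has no fixed majorant at hand; it is bounded by the mollification of
  -- `|g|`, hence the moving majorant.
  have hR : Tendsto (fun m => ∫ x, Φ' (mollify m (K.indicator f) x) *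
      mollify m (K.indicator g) x * φ x) atTop (𝓝 (∫ x, Φ' (f x) * g x * φ x)) := by
    obtain ⟨C, hC⟩ := hφ.continuous.bounded_above_of_compact_support hc
    refine tendsto_integral_of_le_mollify (G := fun x => (B * C) * |K.indicator g x|) ?_
      (hG.abs.const_mul _) ?_ ?_
    · exact fun m => (((hcont.comp (contDiff_mollify hF).continuous).mul
        (contDiff_mollify hG).continuous).mul hφ.continuous).aestronglyMeasurable
    · refine Eventually.of_forall fun m x => ?_
      rw [mollify_const_mul, abs_mul, abs_mul, mul_assoc, mul_comm |mollify m _ x|, ← mul_assoc]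
      have hB0 : 0 ≤ B := (abs_nonneg _).trans (hB 0)
      have hC0 : 0 ≤ C := (norm_nonneg _).trans (hC x)
      exact mul_le_mul (mul_le_mul (hB _) (hC x) (abs_nonneg _) hB0) abs_mollify_le
        (abs_nonneg _) (mul_nonneg hB0 hC0)
    · filter_upwards [ae_tendsto_mollify hF, ae_tendsto_mollify hG] with x hx hx'
      by_cases hxK : x ∈ K
      · rw [indicator_of_mem hxK] at hx hx'
        exact (((hcont.tendsto _).comp hx).mul hx').mul_const _
      · simp [image_eq_zero_of_notMem_tsupport fun h => hxK (hφK h)]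
  refine tendsto_nhds_unique hL ((tendsto_congr' ?_).2 hR.neg)
  filter_upwards [hball] with m hm
  have hFm := contDiff_mollify (m := m) hF
  rw [integral_mul_partialDeriv (f := fun x => Φ (mollify m (K.indicator f) x))
    (hΦ.comp hFm) hφ hc]
  congr 1
  refine integral_congr_ae (Eventually.of_forall fun x => ?_)
  by_cases hx : x ∈ tsupport φ
  · simp only
    rw [← partialDeriv_mollify hfg hK hKΩ (hm x hx)]
    have := (hΦ' (mollify m (K.indicator f) x)).comp_hasFDerivAt x
      (hFm.differentiable (by simp) x).hasFDerivAt
    have h2 : partialDeriv j (fun x => Φ (mollify m (K.indicator f) x)) x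
        = Φ' (mollify m (K.indicator f) x) * partialDeriv j (mollify m (K.indicator f)) x := by
      rw [partialDeriv, partialDeriv]
      erw [this.fderiv]
      rfl
    rw [h2]
  · simp [image_eq_zero_of_notMem_tsupport hx]

/-- As `κ → ∞` these functions tend to 0 uniformly, while their derivatives stay in `(0, 1]` and
tend to the indicator of `{c}`. In the chain rule this isolates the weak derivative on `{f = c}`. -/
lemma hasDerivAt_arctan_scaled {κ : ℝ} (hκ : κ ≠ 0) (c t : ℝ) :
    HasDerivAt (fun t => Real.arctan (κ * (t - c)) / κ) (1 / (1 + (κ * (t - c)) ^ 2)) t := by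
  have h1 : HasDerivAt (fun t => κ * (t - c)) κ t := by
    simpa using ((hasDerivAt_id t).sub_const c).const_mul κ
  have h2 := h1.arctan.div_const κ
  rwa [mul_div_assoc, div_self hκ, mul_one] at h2

/-- A weak derivative vanishes almost everywhere on each level set. -/
theorem IsWeakPartial.ae_eq_zero_of_eq_const (hΩ : IsOpen Ω) (hfg : IsWeakPartial Ω j f g)
    (c : ℝ) : ∀ᵐ x, x ∈ Ω → f x = c → g x = 0 := by
  set D : ℕ → ℝ → ℝ := fun k t => 1 / (1 + (((k : ℝ) + 1) * (t - c)) ^ 2) with hD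
  set W : EuclideanSpace ℝ (Fin n) → ℝ := {x | f x = c}.indicator g with hW
  have hκ : ∀ k : ℕ, ((k : ℝ) + 1) ≠ 0 := fun k => by positivity
  have hDc : ∀ k, Continuous (D k) := fun k =>
    continuous_const.div (by fun_prop) fun t => by positivity
  have hD1 : ∀ k t, |D k t| ≤ 1 := fun k t => by
    rw [abs_of_nonneg (by simp only [hD]; positivity)]
    exact div_le_one_of_le₀ (by nlinarith [sq_nonneg (((k : ℝ) + 1) * (t - c))]) (by positivity)
  have hlim : ∀ x, Tendsto (fun k => D k (f x) * g x) atTop (𝓝 (W x)) := by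
    intro x
    by_cases hx : f x = c
    · have : W x = g x := indicator_of_mem (s := {x | f x = c}) hx g
      rw [this]
      simp [hD, hx]
    · have : W x = 0 * g x := by
        rw [zero_mul]; exact indicator_of_notMem (s := {x | f x = c}) hx g
      rw [this]
      refine Tendsto.mul_const _ ?_
      have h1 : Tendsto (fun k : ℕ => ((k : ℝ) + 1)) atTop atTop :=
        tendsto_atTop_add_const_right _ _ tendsto_natCast_atTop_atTop
      have h2 : Tendsto (fun k : ℕ => 1 + (((k : ℝ) + 1) * (f x - c)) ^ 2) atTop atTop := by
        refine tendsto_atTop_add_const_left _ _ ?_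
        have h3 : 0 < (f x - c) ^ 2 := by positivity [sub_ne_zero.2 hx]
        have := ((tendsto_pow_atTop (two_ne_zero)).comp h1).atTop_mul_const h3
        refine this.congr fun k => ?_
        simp only [Function.comp]
        ring
      simp only [hD, one_div]
      exact h2.inv_tendsto_atTop
  have hWint : ∀ K, IsCompact K → K ⊆ Ω → IntegrableOn W K := by
    intro K hK hKΩ
    have hf := memLp_one_iff_integrable.1 (hfg.1 K hK hKΩ)
    have hg := memLp_one_iff_integrable.1 (hfg.2.1 K hK hKΩ)
    refine hg.abs.mono' ?_ (Eventually.of_forall fun x => ?_)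
    -- The level set of the given representative need not be measurable, so measurability of `W`
    -- comes from its being a pointwise limit.
    · exact aestronglyMeasurable_of_tendsto_ae atTop
        (fun k => ((hDc k).comp_aestronglyMeasurable hf.aestronglyMeasurable).mul
          hg.aestronglyMeasurable) (Eventually.of_forall hlim)
    · exact norm_indicator_le_norm_self _ _
  have key : ∀ᵐ x, x ∈ Ω → W x = 0 := by
    refine hΩ.ae_eq_zero_of_integral_contDiff_smul_eq_zero
      ((locallyIntegrableOn_iff hΩ.isLocallyClosed).2 fun K hKΩ hK => hWint K hK hKΩ) ?_
    intro φ hφ hc hφΩ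
    have hdφ := contDiff_partialDeriv hφ j
    have hdi : Integrable (partialDeriv j φ) :=
      hdφ.continuous.integrable_of_hasCompactSupport (hc.partialDeriv j)
    have hchain : ∀ k : ℕ, ∫ x, D k (f x) * g x * φ x
        = - ∫ x, Real.arctan (((k : ℝ) + 1) * (f x - c)) / ((k : ℝ) + 1) * partialDeriv j φ x := by
      intro k
      -- The constant 2 in `A` bounds `π / 2`; only the decay in `k` matters.
      rw [hfg.integral_comp_mul_partialDeriv hΩ
        (Φ := fun t => Real.arctan (((k : ℝ) + 1) * (t - c)) / ((k : ℝ) + 1)) (Φ' := D k)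
        (A := 2 / ((k : ℝ) + 1)) (B := 1) ?_ (hasDerivAt_arctan_scaled (hκ k) c) ?_ (hD1 k)
        hφ hc hφΩ, neg_neg]
      · exact (Real.contDiff_arctan.comp (by fun_prop)).div_const _
      · intro t
        rw [abs_div, abs_of_nonneg (by positivity : (0 : ℝ) ≤ (k : ℝ) + 1)]
        gcongr
        rw [abs_le]
        have h1 := Real.arctan_lt_pi_div_two (((k : ℝ) + 1) * (t - c))
        have h2 := Real.neg_pi_div_two_lt_arctan (((k : ℝ) + 1) * (t - c))
        constructor <;> linarith [Real.pi_le_four]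
    have hzero : Tendsto (fun k : ℕ => ∫ x, D k (f x) * g x * φ x) atTop (𝓝 0) := by
      have h1 : Tendsto (fun k : ℕ => 2 * (1 / ((k : ℝ) + 1)) * ∫ x, |partialDeriv j φ x|) atTop
          (𝓝 0) := by
        simpa using ((tendsto_one_div_add_atTop_nhds_zero_nat (𝕜 := ℝ)).const_mul 2).mul_const
          (∫ x, |partialDeriv j φ x|)
      refine squeeze_zero_norm (fun k => ?_) h1
      rw [hchain, norm_neg, ← integral_const_mul]
      refine norm_integral_le_of_norm_le (hdi.abs.const_mul _) (Eventually.of_forall fun x => ?_)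
      rw [Real.norm_eq_abs, abs_mul, abs_div, abs_of_nonneg (by positivity : (0 : ℝ) ≤ (k : ℝ) + 1),
        mul_one_div]
      gcongr
      rw [abs_le]
      have h1 := Real.arctan_lt_pi_div_two (((k : ℝ) + 1) * (f x - c))
      have h2 := Real.neg_pi_div_two_lt_arctan (((k : ℝ) + 1) * (f x - c))
      constructor <;> linarith [Real.pi_le_four]
    have hWlim : Tendsto (fun k : ℕ => ∫ x, D k (f x) * g x * φ x) atTop
        (𝓝 (∫ x, φ x • W x)) := by
      have hf := hfg.1.integrable_indicator hc hφΩ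
      have hg := hfg.2.1.integrable_indicator hc hφΩ
      obtain ⟨C, hC⟩ := hφ.continuous.bounded_above_of_compact_support hc
      have hcut : ∀ k x, D k (f x) * g x * φ x = D k ((tsupport φ).indicator f x) *
          (tsupport φ).indicator g x * φ x := by
        intro k x
        by_cases hx : x ∈ tsupport φ
        · simp [hx]
        · simp [image_eq_zero_of_notMem_tsupport hx]
      refine tendsto_integral_of_dominated_convergence
        (fun x => |(tsupport φ).indicator g x| * C) (fun k => ?_) (hg.abs.mul_const C)
        (fun k => Eventually.of_forall fun x => ?_) (Eventually.of_forall fun x => ?_)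
      · simp_rw [hcut]
        exact (((hDc k).comp_aestronglyMeasurable hf.aestronglyMeasurable).mul
          hg.aestronglyMeasurable).mul hφ.continuous.aestronglyMeasurable
      · rw [hcut, norm_mul, norm_mul]
        refine mul_le_mul ?_ (hC x) (norm_nonneg _) (abs_nonneg _)
        exact (mul_le_of_le_one_left (norm_nonneg _) (hD1 k _))
      · rw [smul_eq_mul, mul_comm]
        exact (hlim x).mul_const _
    exact tendsto_nhds_unique hWlim hzero
  filter_upwards [key] with x hx hxΩ hfx
  have := hx hxΩ
  rwa [hW, indicator_of_mem (s := {x | f x = c}) hfx] at this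

end LevelSet

/-! ### Vanishing weak gradient on a connected set -/

section Constancy

variable {n : ℕ} {Ω : Set (EuclideanSpace ℝ (Fin n))} {f : EuclideanSpace ℝ (Fin n) → ℝ}
  {Df : EuclideanSpace ℝ (Fin n) → Fin n → ℝ}

lemma fderiv_eq_zero_of_partialDeriv {v : EuclideanSpace ℝ (Fin n) → ℝ}
    {x : EuclideanSpace ℝ (Fin n)} (h : ∀ j, partialDeriv j v x = 0) : fderiv ℝ v x = 0 := by
  have : (fderiv ℝ v x : EuclideanSpace ℝ (Fin n) →ₗ[ℝ] ℝ) = 0 :=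
    (EuclideanSpace.basisFun (Fin n) ℝ).toBasis.ext fun j => by simpa [partialDeriv] using h j
  exact ContinuousLinearMap.coe_injective this

/-- A function with vanishing weak gradient is locally constant, up to null sets. -/
lemma exists_ball_ae_eq_const (hΩ : IsOpen Ω) (hf : ∀ j, IsWeakPartial Ω j f fun x => Df x j)
    (hn : 0 < n) (hD : ∀ j, ∀ᵐ x, x ∈ Ω → Df x j = 0) {x₀ : EuclideanSpace ℝ (Fin n)}
    (hx₀ : x₀ ∈ Ω) :
    ∃ a : ℝ, ∃ r > 0, ∀ᵐ x, x ∈ Metric.ball x₀ r → f x = a := by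
  obtain ⟨r, hr, hrΩ⟩ := Metric.nhds_basis_closedBall.mem_iff.1 (hΩ.mem_nhds hx₀)
  obtain ⟨K, hK, hKΩ, hrK, hball⟩ := exists_compact_nhd hΩ (isCompact_closedBall x₀ r) hrΩ
  have hF := (hf ⟨0, hn⟩).1.integrable_indicator hK hKΩ
  have hconst : ∀ᶠ m in atTop, ∀ x ∈ Metric.ball x₀ r, ∀ y ∈ Metric.ball x₀ r,
      mollify m (K.indicator f) x = mollify m (K.indicator f) y := by
    filter_upwards [hball] with m hm x hx y hy
    refine Metric.isOpen_ball.is_const_of_fderiv_eq_zero (𝕜 := ℝ)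
      (convex_ball x₀ r).isPreconnected
      ((contDiff_mollify hF).differentiable (by simp)).differentiableOn ?_ hx hy
    intro z hz
    refine fderiv_eq_zero_of_partialDeriv fun j => ?_
    rw [partialDeriv_mollify (hf j) hK hKΩ (hm z (Metric.ball_subset_closedBall hz)),
      mollify_apply_swap]
    refine integral_eq_zero_of_ae ?_
    filter_upwards [hD j] with w hw
    by_cases hwK : w ∈ K
    · simp [hwK, hw (hKΩ hwK)]
    · simp [hwK]
  have hconv := ae_tendsto_mollify hF
  -- A ball has positive measure, so it contains a point where the mollifications converge; as they
  -- are constant on the ball, the limit there is the value of `f` at almost every point of it.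
  obtain ⟨x₁, hx₁, hlim₁⟩ : ∃ x₁ ∈ Metric.ball x₀ r,
      Tendsto (fun m => mollify m (K.indicator f) x₁) atTop (𝓝 (K.indicator f x₁)) := by
    by_contra! hcon
    have h0 : volume (Metric.ball x₀ r) = 0 :=
      measure_mono_null (fun x hx => hcon x hx) (ae_iff.1 hconv)
    exact (Metric.measure_ball_pos volume x₀ hr).ne' h0
  refine ⟨K.indicator f x₁, r, hr, ?_⟩
  filter_upwards [hconv] with x hx hxr
  rw [indicator_of_mem (hrK (Metric.ball_subset_closedBall hxr))] at hx
  refine tendsto_nhds_unique hx (hlim₁.congr' ?_)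
  filter_upwards [hconst] with m hm
  exact hm x₁ hx₁ x hxr

/-- A function with vanishing weak gradient on a connected open set is constant a.e. -/
theorem ae_eq_const_of_weak_gradient_eq_zero (hΩ : IsOpen Ω) (hΩc : IsConnected Ω) (hn : 0 < n)
    (hf : ∀ j, IsWeakPartial Ω j f fun x => Df x j) (hD : ∀ j, ∀ᵐ x, x ∈ Ω → Df x j = 0) :
    ∃ a : ℝ, ∀ᵐ x, x ∈ Ω → f x = a := by
  -- The sets of points near which `f = a` a.e. are open, disjoint for distinct `a`, and together
  -- cover `Ω`; connectedness leaves only one.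
  set S : ℝ → Set (EuclideanSpace ℝ (Fin n)) := fun a =>
    {x | ∃ r > 0, ∀ᵐ y, y ∈ Metric.ball x r → f y = a} with hS
  have hopen : ∀ a, IsOpen (S a) := by
    intro a
    rw [Metric.isOpen_iff]
    rintro x ⟨r, hr, hx⟩
    refine ⟨r, hr, fun y hy => ⟨r - dist y x, sub_pos.2 hy, ?_⟩⟩
    filter_upwards [hx] with z hz hzy
    exact hz (Metric.ball_subset_ball' (by linarith) hzy)
  have hdisj : ∀ a b x, x ∈ S a → x ∈ S b → a = b := by
    rintro a b x ⟨r, hr, ha⟩ ⟨s, hs, hb⟩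
    by_contra hab
    have h0 : volume (Metric.ball x (min r s)) = 0 := by
      refine measure_mono_null (fun y hy => ?_) (ae_iff.1 (ha.and hb))
      rintro ⟨h1, h2⟩
      exact hab ((h1 (Metric.ball_subset_ball (min_le_left _ _) hy)).symm.trans
        (h2 (Metric.ball_subset_ball (min_le_right _ _) hy)))
    exact (Metric.measure_ball_pos volume x (lt_min hr hs)).ne' h0
  obtain ⟨x₀, hx₀⟩ := hΩc.nonempty
  obtain ⟨a, ha⟩ := exists_ball_ae_eq_const hΩ hf hn hD hx₀
  have hsub : Ω ⊆ S a := by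
    refine hΩc.isPreconnected.subset_left_of_subset_union (hopen a)
      (v := ⋃ b ∈ {b | b ≠ a}, S b) (isOpen_biUnion fun b _ => hopen b) ?_ ?_ ⟨x₀, hx₀, ha⟩
    · rw [Set.disjoint_left]
      intro x hx hx'
      simp only [mem_iUnion] at hx'
      obtain ⟨b, hb, hxb⟩ := hx'
      exact hb (hdisj b a x hxb hx)
    · intro x hx
      obtain ⟨b, hb⟩ := exists_ball_ae_eq_const hΩ hf hn hD hx
      by_cases hba : b = a
      · left; rw [← hba]; exact hb
      · right; exact mem_biUnion (x := b) hba hb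
  refine ⟨a, ?_⟩
  rw [ae_iff]
  refine measure_null_of_locally_null _ fun x hx => ?_
  simp only [mem_ofPred_eq, Classical.not_imp] at hx
  obtain ⟨r, hr, hxr⟩ := hsub hx.1
  refine ⟨{y | ¬ (y ∈ Ω → f y = a)} ∩ Metric.ball x r,
    inter_mem_nhdsWithin _ (Metric.ball_mem_nhds x hr), ?_⟩
  refine measure_mono_null (fun y hy => ?_) (ae_iff.1 hxr)
  simp only [mem_inter_iff, mem_ofPred_eq, Classical.not_imp] at hy ⊢
  exact ⟨hy.2, hy.1.2⟩

end Constancy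

/-! ### Conclusion -/

lemma eq_zero_of_cofactorMatrix_mulVec_eq_zero {n : ℕ} {A : Matrix (Fin n) (Fin n) ℝ}
    (hA : A.det ≠ 0) {w : Fin n → ℝ} (hw : ∀ i, ∑ j, cofactorMatrix A i j * w j = 0) :
    w = 0 := by
  have h1 : cofactorMatrix A *ᵥ w = 0 := funext hw
  have h2 : Aᵀ * cofactorMatrix A = A.det • (1 : Matrix (Fin n) (Fin n) ℝ) := by
    rw [cofactorMatrix, ← Matrix.transpose_mul, Matrix.adjugate_mul, Matrix.transpose_smul,
      Matrix.transpose_one]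
  have h3 : A.det • w = 0 := by
    rw [← Matrix.one_mulVec w, ← Matrix.smul_mulVec, ← h2, ← Matrix.mulVec_mulVec, h1,
      Matrix.mulVec_zero]
  exact (smul_eq_zero.1 h3).resolve_left hA

theorem proposition2p4 {n : ℕ} (hn : 2 ≤ n)
    (Ω : Set (EuclideanSpace ℝ (Fin n))) (hΩ_open : IsOpen Ω) (hΩ_conn : IsConnected Ω)
    (hΩ_bdd : Bornology.IsBounded Ω)
    (h : ℝ → ℝ) (hh : Continuous h)
    (p : ℝ≥0∞) (hp : (n : ℝ≥0∞) - 1 ≤ p)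
    (u : EuclideanSpace ℝ (Fin n) → EuclideanSpace ℝ (Fin n))
    (Du : EuclideanSpace ℝ (Fin n) → Matrix (Fin n) (Fin n) ℝ)
    (hu : IsSobolevMapLoc Ω p u Du)
    (hsol : IsWeakSolution Ω h u Du)
    (hdet : MemSobolevLoc Ω (barExponent n p) (fun x => h (Du x).det)) :
    ∃ c : ℝ, ∀ᵐ x ∂(volume.restrict Ω), h (Du x).det = c := by
  obtain ⟨Df, hf⟩ := hdet
  have hcof : ∀ᵐ x, ∀ i, x ∈ Ω → ∑ j, cofactorMatrix (Du x) i j * Df x j = 0 :=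
    ae_all_iff.2 fun i => hsol.ae_sum_cofactorMatrix_mul_eq_zero hΩ_open hn hp hu hf i
  have hgrad : ∀ j, ∀ᵐ x, x ∈ Ω → Df x j = 0 := by
    intro j
    filter_upwards [hcof, (hf.isWeakPartial j).ae_eq_zero_of_eq_const hΩ_open (h 0)]
      with x hx hx' hxΩ
    -- Where the cofactor matrix may degenerate, `f` equals `h 0`, so the level set result at that
    -- one value covers the whole degenerate set.
    by_cases hd : (Du x).det = 0
    · exact hx' hxΩ (by rw [hd])
    · exact congrFun (eq_zero_of_cofactorMatrix_mulVec_eq_zero hd fun i => hx i hxΩ) j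
  obtain ⟨c, hc⟩ := ae_eq_const_of_weak_gradient_eq_zero hΩ_open hΩ_conn (by omega)
    hf.isWeakPartial hgrad
  exact ⟨c, (ae_restrict_iff' hΩ_open.measurableSet).2 hc⟩
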